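/- Let $G=(V,E)$ be a finite simple graph without isolated vertices. For a bijection $f:E\to\{1,2,\dots,|E|\}$ and a vertex $u\in V$, let $w(u)=\sum_{e\ni u}f(e)$ be the sum of the labels of the edges incident to $u$. The bijection $f$ is a local antimagic labeling of $G$ if $w(u)\neq w(v)$ for any two adjacent vertices $u,v$, and the local antimagic chromatic number $\chi_{la}(G)$ is the minimum, over all local antimagic labelings $f$ of $G$, of the number $|\{w(u):u\in V\}|$ of distinct vertex sums. A complete full $t$-ary tree is a finite rooted tree in which every vertex that is not a leaf has exactly $t$ children and all leaves have the same depth. Theorem. Let $t\ge 2$ be even and let $T$ be a complete full $t$-ary tree with more than one vertex. Then $$l+1\le\chi_{la}(T)\le l+2,$$ where $l$ is the number of leaves of $T$. That is, $T$ has a local antimagic labeling, and $\chi_{la}(T)$ is either $l+1$ or $l+2$. -/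

import Mathlib

/-- The colour (vertex sum, weight) `w(u)` of the vertex `u` under an edge labelling `f`: the sum of
the labels of the edges incident to `u`. -/
def vertexSum {V : Type*} [Fintype V] [DecidableEq V] (G : SimpleGraph V) [DecidableRel G.Adj]
    (f : Sym2 V → ℕ) (u : V) : ℕ :=
  ∑ e ∈ G.incidenceFinset u, f e

/-- `f` restricts to a local antimagic labelling of `G`: it maps the edge set bijectively onto
`{1, …, |E(G)|}`, and adjacent vertices have different vertex sums. The values of `f` outside the
edge set play no role. -/
structure IsLocalAntimagicLabeling {V : Type*} [Fintype V] [DecidableEq V] (G : SimpleGraph V)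
    [DecidableRel G.Adj] (f : Sym2 V → ℕ) : Prop where
  bijOn : Set.BijOn f G.edgeSet (Set.Icc 1 G.edgeFinset.card)
  vertexSum_ne : ∀ u v : V, G.Adj u v → vertexSum G f u ≠ vertexSum G f v

/-- The local antimagic chromatic number: the minimum, over all local antimagic labellings `f` of
`G`, of the number of colours (distinct vertex sums) that `f` induces; it is `⊤` if `G` has no
local antimagic labelling. -/
noncomputable def localAntimagicChromaticNumber {V : Type*} [Fintype V] [DecidableEq V]
    (G : SimpleGraph V) [DecidableRel G.Adj] : ℕ∞ :=
  ⨅ (f : Sym2 V → ℕ) (_ : IsLocalAntimagicLabeling G f),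
    ((Finset.univ.image (vertexSum G f)).card : ℕ∞)

/-- The children of `v` in the tree `T` rooted at `r`: the neighbours of `v` that are one step
further away from the root. -/
def rootedChildren {V : Type*} (T : SimpleGraph V) (r v : V) : Set V :=
  {w | T.Adj v w ∧ T.dist r w = T.dist r v + 1}

/-- The tree `T` rooted at `r` is a complete full `t`-ary tree: every node which is not a leaf
(which has a child) has exactly `t` children, and all leaves (nodes without children) have the same
depth. -/
structure IsCompleteFullTree {V : Type*} (T : SimpleGraph V) (r : V) (t : ℕ) : Prop where
  isTree : T.IsTree
  ncard_children : ∀ v : V, rootedChildren T r v ≠ ∅ → (rootedChildren T r v).ncard = t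
  depth_eq : ∀ u v : V, rootedChildren T r u = ∅ → rootedChildren T r v = ∅ →
    T.dist r u = T.dist r v

/-! Lower bound: the sum at a leaf is the label of its only edge, so the leaves have distinct
colours, all at most |E|, while one end of the edge labelled |E| has a larger sum
(`le_localAntimagicChromaticNumber`).

Upper bound: let t = 2h and let the leaves have depth d + 2, the star being easy. The aim is that
all sums except two values lie among the labels of the leaf edges
(`IsFullDepth.exists_labelling_of_two_le`). The M edges not at leaves get 1, ..., M, siblings being
paired so that each pair sums to M + 1; the leaf edges get M + 1, ..., M + l. A vertex of depth at
most d then has sum h(M + 1), plus its parent edge's label if it is not the root. Levels grow so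
fast that this is at most M + l.

The 2k vertices of depth d + 1 have parent edges labelled by an interval x + 1, ..., x + 2k. Below
the one labelled x + i, the leaf labels compensate for i, so that only two sums C and C + 1 occur
(`sum_leafLabel`), both above M + l. All colours thus lie in [M + 1, M + l] ∪ {C, C + 1}. -/

open Finset

/-! ### Vertex sums and the lower bound. -/

section VertexSums

variable {V : Type*} [Fintype V] [DecidableEq V] (G : SimpleGraph V) [DecidableRel G.Adj]

theorem vertexSum_eq_sum_neighborFinset (f : Sym2 V → ℕ) (u : V) :
    vertexSum G f u = ∑ w ∈ G.neighborFinset u, f s(u, w) := by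
  have h : G.incidenceFinset u = (G.neighborFinset u).image fun w => s(u, w) := by
    ext e
    induction e with
    | _ a b =>
      simp only [SimpleGraph.mem_incidenceFinset, SimpleGraph.incidenceSet, mem_image,
        SimpleGraph.mem_neighborFinset, Set.mem_ofPred_eq, SimpleGraph.mem_edgeSet, Sym2.mem_iff]
      constructor
      · rintro ⟨hab, rfl | rfl⟩
        · exact ⟨b, hab, rfl⟩
        · exact ⟨a, hab.symm, Sym2.eq_swap⟩
      · rintro ⟨w, hw, he⟩
        rw [Sym2.eq_iff] at he
        rcases he with ⟨rfl, rfl⟩ | ⟨rfl, rfl⟩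
        · exact ⟨hw, Or.inl rfl⟩
        · exact ⟨hw.symm, Or.inr rfl⟩
  rw [vertexSum, h, sum_image]
  intro a _ b _ hab
  exact Sym2.congr_right.1 hab

variable {G}

theorem vertexSum_eq_of_degree_eq_one {f : Sym2 V → ℕ} {u : V} (hu : G.degree u = 1) :
    ∃ w, G.Adj u w ∧ vertexSum G f u = f s(u, w) := by
  rw [← SimpleGraph.card_neighborFinset_eq_degree, card_eq_one] at hu
  obtain ⟨w, hw⟩ := hu
  refine ⟨w, ?_, ?_⟩
  · rw [← SimpleGraph.mem_neighborFinset, hw, mem_singleton]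
  · rw [vertexSum_eq_sum_neighborFinset, hw, sum_singleton]

/-- Equal sums mean that the two pendant edges coincide; two distinct ends of one edge would be
adjacent with equal sums. -/
theorem IsLocalAntimagicLabeling.injOn_vertexSum {f : Sym2 V → ℕ}
    (hf : IsLocalAntimagicLabeling G f) :
    Set.InjOn (vertexSum G f) {v | G.degree v = 1} := by
  intro u hu v hv huv
  obtain ⟨a, ha, hua⟩ := vertexSum_eq_of_degree_eq_one (f := f) hu
  obtain ⟨b, hb, hvb⟩ := vertexSum_eq_of_degree_eq_one (f := f) hv
  have he : s(u, a) = s(v, b) := hf.bijOn.injOn ha hb (by rw [← hua, ← hvb, huv])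
  rw [Sym2.eq_iff] at he
  rcases he with ⟨h, _⟩ | ⟨_, h⟩
  · exact h
  · exact (hf.vertexSum_ne u v (h ▸ ha) huv).elim

/-- Both ends of the edge labelled |E| have sum at least |E|, and being adjacent they cannot both
attain it. -/
theorem IsLocalAntimagicLabeling.exists_card_lt_vertexSum {f : Sym2 V → ℕ}
    (hf : IsLocalAntimagicLabeling G f) (hE : 0 < G.edgeFinset.card) :
    ∃ v, G.edgeFinset.card < vertexSum G f v := by
  obtain ⟨e, he, hfe⟩ := hf.bijOn.surjOn (show G.edgeFinset.card ∈ Set.Icc 1 _ from ⟨hE, le_rfl⟩)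
  induction e with
  | _ a b =>
    have hab : G.Adj a b := he
    have hle : ∀ x y, G.Adj x y → f s(x, y) ≤ vertexSum G f x := fun x y hxy => by
      rw [vertexSum_eq_sum_neighborFinset]
      exact single_le_sum (f := fun w => f s(x, w)) (fun _ _ => Nat.zero_le _)
        ((G.mem_neighborFinset x y).2 hxy)
    have h1 := hle a b hab
    have h2 := hle b a hab.symm
    rw [Sym2.eq_swap] at h2
    have h3 := hf.vertexSum_ne a b hab
    by_contra! hlt
    have := hlt a
    have := hlt b
    omega

theorem le_localAntimagicChromaticNumber (hE : 0 < G.edgeFinset.card) :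
    ((univ.filter fun v : V => G.degree v = 1).card : ℕ∞) + 1 ≤
      localAntimagicChromaticNumber G := by
  refine le_iInf₂ fun f hf => ?_
  obtain ⟨v, hv⟩ := hf.exists_card_lt_vertexSum hE
  have hnot : vertexSum G f v ∉
      (univ.filter fun v : V => G.degree v = 1).image (vertexSum G f) := by
    intro h
    obtain ⟨u, hu, huv⟩ := mem_image.1 h
    obtain ⟨w, hw, hs⟩ := vertexSum_eq_of_degree_eq_one (f := f) (mem_filter.1 hu).2
    have := (hf.bijOn.mapsTo (G.mem_edgeSet.2 hw)).2
    omega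
  have hcard := card_le_card (insert_subset (mem_image_of_mem _ (mem_univ v))
    (image_subset_image (f := vertexSum G f)
      (filter_subset (fun v : V => G.degree v = 1) univ)))
  rw [card_insert_of_notMem hnot, card_image_of_injOn] at hcard
  · exact_mod_cast hcard
  · intro a ha b hb hab
    exact hf.injOn_vertexSum (by simpa using ha) (by simpa using hb) hab

end VertexSums

/-! ### Edge labellings of a rooted tree as functions on its non-root vertices. -/

section RootedTrees

variable {V : Type*}

/-- The parent is the penultimate vertex of the path from the root; uniqueness of paths in a tree
excludes any other candidate. -/
theorem exists_parent {T : SimpleGraph V} (hT : T.IsTree) (r : V) :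
    ∃ p : V → V, ∀ w, w ≠ r → ∀ a, (T.Adj a w ∧ T.dist r w = T.dist r a + 1) ↔ p w = a := by
  have key : ∀ w, ∃ b, w ≠ r → ∀ a, (T.Adj a w ∧ T.dist r w = T.dist r a + 1) ↔ b = a := by
    intro w
    by_cases hw : w = r
    · exact ⟨r, fun h => (h hw).elim⟩
    obtain ⟨q, hq, hlen⟩ := hT.connected.exists_path_of_dist r w
    have huniq : ∀ a, T.Adj a w → T.dist r w = T.dist r a + 1 → q.penultimate = a := by
      intro a ha hd
      obtain ⟨q', hq', hlen'⟩ := hT.connected.exists_path_of_dist r a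
      have hp : (q'.concat ha).IsPath :=
        SimpleGraph.Walk.isPath_of_length_eq_dist _ (by simp [hlen', hd])
      have := (hT.isAcyclic.subsingleton_path _ _).elim ⟨q, hq⟩ ⟨_, hp⟩
      have h2 : q = q'.concat ha := congrArg Subtype.val this
      rw [h2, SimpleGraph.Walk.penultimate_concat]
    have hnil : ¬ q.Nil := fun h => hw h.eq.symm
    have hadj := q.adj_penultimate hnil
    have hdist : T.dist r w = T.dist r q.penultimate + 1 := by
      rcases hT.dist_eq_dist_add_one_of_adj r hadj with h | h
      · have hle := SimpleGraph.dist_le q.dropLast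
        have : q.dropLast.length = q.length - 1 := by simp
        omega
      · exact h
    refine ⟨q.penultimate, fun _ a => ⟨fun h => huniq a h.1 h.2, ?_⟩⟩
    rintro rfl
    exact ⟨hadj, hdist⟩
  choose p hp using key
  exact ⟨p, hp⟩

/-- The children of `v` in the tree with root `r` and parent map `p`. -/
def childFinset [Fintype V] [DecidableEq V] (r : V) (p : V → V) (v : V) : Finset V :=
  univ.filter fun w => w ≠ r ∧ p w = v

theorem mem_childFinset [Fintype V] [DecidableEq V] {r : V} {p : V → V} {v w : V} :
    w ∈ childFinset r p v ↔ w ≠ r ∧ p w = v := by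
  simp [childFinset]

/-- The vertex sum of `v` when the edge from `w` to its parent has the label `g w`. -/
def rootedSum [Fintype V] [DecidableEq V] (r : V) (p : V → V) (g : V → ℕ) (v : V) : ℕ :=
  (if v = r then 0 else g v) + ∑ w ∈ childFinset r p v, g w

/-- The labelling of the pairs of vertices by a labelling `g` of the end that is further away
from the root. -/
def edgeLabel (ℓ : V → ℕ) (g : V → ℕ) : Sym2 V → ℕ :=
  -- The value 0 is for pairs of equal depth, which are never adjacent in a tree.
  Sym2.lift ⟨fun a b => if ℓ a < ℓ b then g b else if ℓ b < ℓ a then g a else 0, by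
    intro a b
    dsimp only
    split_ifs <;> first | rfl | omega⟩

theorem edgeLabel_of_lt {ℓ g : V → ℕ} {a b : V} (h : ℓ a < ℓ b) :
    edgeLabel ℓ g s(a, b) = g b := by
  simp [edgeLabel, h]

theorem edgeLabel_of_gt {ℓ g : V → ℕ} {a b : V} (h : ℓ b < ℓ a) :
    edgeLabel ℓ g s(a, b) = g a := by
  rw [Sym2.eq_swap, edgeLabel_of_lt h]

variable {T : SimpleGraph V} {r : V} {p : V → V}

theorem adj_iff_parent (hT : T.IsTree)
    (hp : ∀ w, w ≠ r → ∀ a, (T.Adj a w ∧ T.dist r w = T.dist r a + 1) ↔ p w = a) (u v : V) :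
    T.Adj u v ↔ (u ≠ r ∧ p u = v) ∨ (v ≠ r ∧ p v = u) := by
  constructor
  · intro h
    rcases hT.dist_eq_dist_add_one_of_adj r h with hd | hd
    · have hu : u ≠ r := by rintro rfl; simp at hd
      exact Or.inl ⟨hu, (hp u hu v).1 ⟨h.symm, hd⟩⟩
    · have hv : v ≠ r := by rintro rfl; simp at hd
      exact Or.inr ⟨hv, (hp v hv u).1 ⟨h, hd⟩⟩
  · rintro (⟨hu, h⟩ | ⟨hv, h⟩)
    · exact ((hp u hu v).2 h).1.symm
    · exact ((hp v hv u).2 h).1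

variable [Fintype V] [DecidableEq V]

theorem disjoint_parent_childFinset
    (hp : ∀ w, w ≠ r → ∀ a, (T.Adj a w ∧ T.dist r w = T.dist r a + 1) ↔ p w = a) (u : V) :
    Disjoint (if u = r then ∅ else {p u}) (childFinset r p u) := by
  split_ifs with h
  · exact disjoint_empty_left _
  · rw [disjoint_singleton_left, mem_childFinset]
    rintro ⟨h1, h2⟩
    have h3 := ((hp u h _).2 rfl).2
    have h4 := ((hp _ h1 _).2 h2).2
    omega

variable [DecidableRel T.Adj]

theorem neighborFinset_eq_parent (hT : T.IsTree)
    (hp : ∀ w, w ≠ r → ∀ a, (T.Adj a w ∧ T.dist r w = T.dist r a + 1) ↔ p w = a) (u : V) :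
    T.neighborFinset u = (if u = r then ∅ else {p u}) ∪ childFinset r p u := by
  ext w
  rw [SimpleGraph.mem_neighborFinset, adj_iff_parent hT hp, mem_union, mem_childFinset]
  split_ifs with h
  · simp [h]
  · simp [h, eq_comm]

theorem degree_eq_parent (hT : T.IsTree)
    (hp : ∀ w, w ≠ r → ∀ a, (T.Adj a w ∧ T.dist r w = T.dist r a + 1) ↔ p w = a) (u : V) :
    T.degree u = (if u = r then 0 else 1) + (childFinset r p u).card := by
  rw [← SimpleGraph.card_neighborFinset_eq_degree, neighborFinset_eq_parent hT hp,
    card_union_of_disjoint (disjoint_parent_childFinset hp u)]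
  split_ifs <;> simp

theorem vertexSum_edgeLabel (hT : T.IsTree)
    (hp : ∀ w, w ≠ r → ∀ a, (T.Adj a w ∧ T.dist r w = T.dist r a + 1) ↔ p w = a)
    (g : V → ℕ) (u : V) :
    vertexSum T (edgeLabel (T.dist r) g) u = rootedSum r p g u := by
  rw [vertexSum_eq_sum_neighborFinset, neighborFinset_eq_parent hT hp,
    sum_union (disjoint_parent_childFinset hp u), rootedSum]
  congr 1
  · split_ifs with h
    · simp
    · have := ((hp u h _).2 rfl).2
      rw [sum_singleton, edgeLabel_of_gt (by omega)]
  · refine sum_congr rfl fun w hw => ?_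
    rw [mem_childFinset] at hw
    have := ((hp w hw.1 _).2 hw.2).2
    rw [edgeLabel_of_lt (by omega)]

/-- Non-root vertices correspond to edges and |E| = |V| - 1, so injectivity and the bounds already
give surjectivity. -/
theorem isLocalAntimagicLabeling_edgeLabel (hT : T.IsTree)
    (hp : ∀ w, w ≠ r → ∀ a, (T.Adj a w ∧ T.dist r w = T.dist r a + 1) ↔ p w = a)
    {g : V → ℕ} (hinj : Set.InjOn g {v | v ≠ r})
    (hmaps : ∀ v, v ≠ r → 1 ≤ g v ∧ g v ≤ Fintype.card V - 1)
    (hne : ∀ v, v ≠ r → rootedSum r p g v ≠ rootedSum r p g (p v)) :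
    IsLocalAntimagicLabeling T (edgeLabel (T.dist r) g) := by
  have hE := hT.card_edgeFinset
  have hlab : ∀ e ∈ T.edgeSet, ∃ v, v ≠ r ∧ e = s(p v, v) ∧
      edgeLabel (T.dist r) g e = g v := by
    intro e he
    induction e with
    | _ a b =>
      rcases (adj_iff_parent hT hp a b).1 he with ⟨h, rfl⟩ | ⟨h, rfl⟩
      · have := ((hp a h _).2 rfl).2
        exact ⟨a, h, Sym2.eq_swap, edgeLabel_of_gt (by omega)⟩
      · have := ((hp b h _).2 rfl).2
        exact ⟨b, h, rfl, edgeLabel_of_lt (by omega)⟩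
  have hmt : Set.MapsTo (edgeLabel (T.dist r) g) T.edgeSet (Set.Icc 1 T.edgeFinset.card) := by
    intro e he
    obtain ⟨v, hv, -, h⟩ := hlab e he
    have := hmaps v hv
    rw [h, Set.mem_Icc]
    omega
  have hij : Set.InjOn (edgeLabel (T.dist r) g) T.edgeSet := by
    intro e he e' he' h
    obtain ⟨v, hv, rfl, h1⟩ := hlab e he
    obtain ⟨v', hv', rfl, h2⟩ := hlab e' he'
    rw [hinj hv hv' (by rw [← h1, ← h2, h])]
  refine ⟨⟨hmt, hij, ?_⟩, ?_⟩
  · have := surjOn_of_injOn_of_card_le (s := T.edgeFinset) (t := Icc 1 T.edgeFinset.card)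
      (edgeLabel (T.dist r) g) (by simpa using hmt) (by simpa using hij) (by simp)
    simpa using this
  · intro u v huv
    rw [vertexSum_edgeLabel hT hp, vertexSum_edgeLabel hT hp]
    rcases (adj_iff_parent hT hp u v).1 huv with ⟨h, rfl⟩ | ⟨h, rfl⟩
    · exact hne u h
    · exact (hne v h).symm

end RootedTrees

/-! ### Arithmetic of the two label patterns. -/

section LabelArithmetic

theorem sum_range_two_mul (φ : ℕ → ℕ) (h : ℕ) :
    ∑ c ∈ range (2 * h), φ c = ∑ j ∈ range h, (φ (2 * j) + φ (2 * j + 1)) := by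
  induction h with
  | zero => simp
  | succ h ih => rw [mul_add_one, sum_range_succ, sum_range_succ, ih, sum_range_succ]; ring

theorem mul_add_inj {h a b i j : ℕ} (hi : i < h) (hj : j < h) (heq : a * h + i = b * h + j) :
    a = b ∧ i = j := by
  have hpos : 0 < h := by omega
  have h1 : a = b := by
    have := congrArg (· / h) heq
    simpa [Nat.add_div_of_dvd_right, Nat.mul_div_cancel _ hpos, Nat.div_eq_of_lt hi,
      Nat.div_eq_of_lt hj, Nat.add_comm, Nat.add_mul_div_right _ _ hpos] using this
  subst h1
  exact ⟨rfl, by omega⟩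

/-- The label of the `c`-th of `2 * h` siblings whose parent has the index `e`. The labels of
the siblings form `h` pairs with sum `2 * N + 1`. -/
def upperLabel (h N e c : ℕ) : ℕ :=
  if c % 2 = 0 then e * h + c / 2 + 1 else 2 * N - (e * h + c / 2)

/-- Large indices give labels near the middle: the two labels of a pair move towards each other as
the index grows. -/
theorem upperLabel_bounds {h x N e c : ℕ} (hc : c < 2 * h) (hx : x ≤ e) (he : e < N) :
    h * x + 1 ≤ upperLabel h (h * N) e c ∧ upperLabel h (h * N) e c ≤ 2 * (h * N) - h * x := by
  have h1 : h * x ≤ e * h := by rw [mul_comm e]; exact Nat.mul_le_mul_left h hx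
  have h2 : e * h + h ≤ h * N := by
    rw [← Nat.succ_mul, mul_comm h]; exact Nat.mul_le_mul_right h he
  unfold upperLabel
  split_ifs <;> omega

theorem upperLabel_inj {h N e c e' c' : ℕ} (hc : c < 2 * h) (hc' : c' < 2 * h) (he : e < N)
    (he' : e' < N) (heq : upperLabel h (h * N) e c = upperLabel h (h * N) e' c') :
    e = e' ∧ c = c' := by
  have h1 : e * h + h ≤ h * N := by
    rw [← Nat.succ_mul, mul_comm h]; exact Nat.mul_le_mul_right h he
  have h2 : e' * h + h ≤ h * N := by
    rw [← Nat.succ_mul, mul_comm h]; exact Nat.mul_le_mul_right h he'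
  have h3 : e * h + c / 2 = e' * h + c' / 2 ∧ c % 2 = c' % 2 := by
    unfold upperLabel at heq
    split_ifs at heq <;> omega
  obtain ⟨h4, h5⟩ := mul_add_inj (h := h) (by omega) (by omega) h3.1
  exact ⟨h4, by omega⟩

theorem sum_upperLabel {h N e : ℕ} (he : e < N) :
    ∑ c ∈ range (2 * h), upperLabel h (h * N) e c = h * (2 * (h * N) + 1) := by
  have h1 : e * h + h ≤ h * N := by
    rw [← Nat.succ_mul, mul_comm h]; exact Nat.mul_le_mul_right h he
  rw [sum_range_two_mul, sum_congr rfl (g := fun _ => 2 * (h * N) + 1), sum_const, card_range,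
    smul_eq_mul]
  intro j hj
  rw [mem_range] at hj
  have h2 : 2 * j % 2 = 0 := by omega
  have h3 : (2 * j + 1) % 2 ≠ 0 := by omega
  simp only [upperLabel, h2, h3, if_true, if_false]
  omega

/-- The block of `2 * k` consecutive labels that contains the label of a leaf which is the `c`-th
of `2 * h` siblings. -/
def leafBlock (h c : ℕ) : ℕ :=
  if c = 0 then 0 else if c = 1 then 1 else if c % 2 = 0 then c / 2 + 1 else 2 * h - c / 2

/-- The position inside its block of the label of the `c`-th child of the `i`-th vertex. -/
def leafOffset (k i c : ℕ) : ℕ :=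
  if c = 0 then (if i ≤ k then k + i else i - k)
  else if c = 1 then (if i ≤ k then 2 * k + 2 - 2 * i else 4 * k + 1 - 2 * i)
  else if c % 2 = 0 then i else 2 * k + 1 - i

/-- The label of the `c`-th child of the `i`-th vertex in the level above the leaves. -/
def leafLabel (M h k i c : ℕ) : ℕ :=
  M + (leafBlock h c * (2 * k) + leafOffset k i c)

theorem leafOffset_bounds {k i : ℕ} (c : ℕ) (hi : 1 ≤ i) (hi' : i ≤ 2 * k) :
    1 ≤ leafOffset k i c ∧ leafOffset k i c ≤ 2 * k := by
  unfold leafOffset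
  split_ifs <;> omega

theorem leafLabel_bounds {M h k i c : ℕ} (hc : c < 2 * h) (hi : 1 ≤ i) (hi' : i ≤ 2 * k) :
    M + 1 ≤ leafLabel M h k i c ∧ leafLabel M h k i c ≤ M + 2 * h * (2 * k) := by
  have h1 := leafOffset_bounds c hi hi'
  have h2 : leafBlock h c + 1 ≤ 2 * h := by
    unfold leafBlock
    split_ifs <;> omega
  have h3 := Nat.mul_le_mul_right (2 * k) h2
  rw [Nat.add_mul, one_mul] at h3
  unfold leafLabel
  omega

/-- The block determines `c`. Within a block the offset permutes 1, ..., 2k: a rotation by k for `c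
= 0`, evens then odds (both descending) for `c = 1`, the identity or the reflection otherwise. -/
theorem leafLabel_inj {M h k i c i' c' : ℕ} (hc : c < 2 * h) (hc' : c' < 2 * h) (hi : 1 ≤ i)
    (hi2 : i ≤ 2 * k) (hi' : 1 ≤ i') (hi2' : i' ≤ 2 * k)
    (heq : leafLabel M h k i c = leafLabel M h k i' c') : i = i' ∧ c = c' := by
  have h1 := leafOffset_bounds c hi hi2
  have h2 := leafOffset_bounds c' hi' hi2'
  unfold leafLabel at heq
  obtain ⟨h3, h4⟩ := mul_add_inj (h := 2 * k) (a := leafBlock h c) (b := leafBlock h c')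
    (i := leafOffset k i c - 1) (j := leafOffset k i' c' - 1) (by omega) (by omega) (by omega)
  have h5 : c = c' := by
    unfold leafBlock at h3
    split_ifs at h3 <;> omega
  subst h5
  refine ⟨?_, rfl⟩
  have h6 : leafOffset k i c = leafOffset k i' c := by omega
  unfold leafOffset at h6
  split_ifs at h6 <;> omega

/-- Adding i to the first two offsets gives 3k + 2 if i ≤ k and 3k + 1 otherwise. Each later pair
has offsets i and 2k + 1 - i and block numbers adding up to 2h + 1, so its sum does not depend on i.
-/
theorem sum_leafLabel {M h k i : ℕ} (hh : 1 ≤ h) (hi' : i ≤ 2 * k) :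
    i + ∑ c ∈ range (2 * h), leafLabel M h k i c =
      2 * M + 5 * k + (h - 1) * (2 * M + (2 * h + 2) * (2 * k) + 1) + if i ≤ k then 2 else 1 := by
  obtain ⟨h, rfl⟩ : ∃ h', h = h' + 1 := ⟨h - 1, by omega⟩
  rw [sum_range_two_mul, sum_range_succ', sum_congr rfl
    (g := fun _ => 2 * M + (2 * (h + 1) + 2) * (2 * k) + 1), sum_const, card_range, smul_eq_mul,
    Nat.add_sub_cancel]
  · generalize h * _ = A
    simp only [leafLabel, leafBlock, leafOffset, mul_zero, zero_add, one_ne_zero, if_true, if_false]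
    split_ifs <;> omega
  · intro j hj
    rw [mem_range] at hj
    have h1 : 2 * (j + 1) % 2 = 0 := by omega
    have h2 : (2 * (j + 1) + 1) % 2 ≠ 0 := by omega
    have h3 : 2 * (j + 1) ≠ 0 := by omega
    have h4 : 2 * (j + 1) ≠ 1 := by omega
    have h5 : 2 * (j + 1) + 1 ≠ 0 := by omega
    have h6 : 2 * (j + 1) + 1 ≠ 1 := by omega
    simp only [leafLabel, leafBlock, leafOffset, h1, h2, h3, h4, h5, h6, if_true, if_false]
    have h7 : (2 * (j + 1) / 2 + 1) * (2 * k) +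
        (2 * (h + 1) - (2 * (j + 1) + 1) / 2) * (2 * k) + 2 * k
        = (2 * (h + 1) + 2) * (2 * k) := by
      rw [← Nat.add_mul, ← Nat.succ_mul]
      congr 1
      omega
    omega

end LabelArithmetic

/-! ### Enumerations of vertices and counting of children. -/

section Enumeration

variable {V : Type*} [DecidableEq V]

theorem exists_bijOn_range (s : Finset V) : ∃ f : V → ℕ, Set.BijOn f s (range s.card) := by
  refine ⟨fun v => if h : v ∈ s then (s.equivFin ⟨v, h⟩ : ℕ) else 0, ?_, ?_, ?_⟩
  · intro v hv
    have hv' : v ∈ s := hv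
    simp [hv']
  · intro a ha b hb hab
    have ha' : a ∈ s := ha
    have hb' : b ∈ s := hb
    simpa [ha', hb', Fin.val_inj] using hab
  · intro j hj
    have hj' : j < s.card := by simpa using hj
    exact ⟨s.equivFin.symm ⟨j, hj'⟩, (s.equivFin.symm ⟨j, hj'⟩).2, by simp⟩

theorem exists_injOn_subset_first {s w : Finset V} (hsw : s ⊆ w) :
    ∃ e : V → ℕ, Set.InjOn e w ∧ (∀ v ∈ w, e v < w.card) ∧ ∀ v ∈ w \ s, s.card ≤ e v := by
  obtain ⟨f, hf⟩ := exists_bijOn_range s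
  obtain ⟨g, hg⟩ := exists_bijOn_range (w \ s)
  have hcard := card_sdiff_add_card_eq_card hsw
  have h1 : ∀ v ∈ s, f v < s.card := fun v hv => by simpa using hf.mapsTo hv
  have h2 : ∀ v ∈ w \ s, g v < (w \ s).card := fun v hv => by simpa using hg.mapsTo hv
  refine ⟨fun v => if v ∈ s then f v else s.card + g v, ?_, ?_, ?_⟩
  · intro a ha b hb hab
    dsimp only at hab
    by_cases has : a ∈ s <;> by_cases hbs : b ∈ s <;> simp only [has, hbs, if_true, if_false] at hab
    · exact hf.injOn has hbs hab
    · have := h1 a has; omega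
    · have := h1 b hbs; omega
    · exact hg.injOn (mem_sdiff.2 ⟨ha, has⟩) (mem_sdiff.2 ⟨hb, hbs⟩) (by omega)
  · intro v hv
    by_cases hs : v ∈ s
    · simpa [hs] using (h1 v hs).trans_le (card_le_card hsw)
    · have := h2 v (mem_sdiff.2 ⟨hv, hs⟩)
      simp only [hs, if_false]
      omega
  · intro v hv
    simp [(mem_sdiff.1 hv).2]

variable [Fintype V] {r : V} {p : V → V}

theorem exists_childIndex (r : V) (p : V → V) :
    ∃ c : V → ℕ, ∀ v, Set.BijOn c (childFinset r p v) (range (childFinset r p v).card) := by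
  choose f hf using fun v => exists_bijOn_range (childFinset r p v)
  refine ⟨fun w => f (p w) w, fun v => (hf v).congr fun w hw => ?_⟩
  rw [(mem_childFinset.1 hw).2]

theorem card_filter_parent_mem {s : Finset V} {t : ℕ}
    (hs : ∀ v ∈ s, (childFinset r p v).card = t) :
    (univ.filter fun w => w ≠ r ∧ p w ∈ s).card = t * s.card := by
  rw [card_eq_sum_card_fiberwise (f := p) (t := s) fun w hw => (mem_filter.1 hw).2.2,
    sum_congr rfl (g := fun _ => t), sum_const, smul_eq_mul, mul_comm]
  intro v hv
  rw [← hs v hv]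
  congr 1
  ext w
  simp only [mem_filter, mem_univ, true_and, mem_childFinset]
  constructor
  · rintro ⟨⟨h1, _⟩, h2⟩; exact ⟨h1, h2⟩
  · rintro ⟨h1, rfl⟩; exact ⟨⟨h1, hv⟩, rfl⟩

end Enumeration

/-! ### The labelling of a complete full tree. -/

section Labelling

variable {V : Type*} [Fintype V] [DecidableEq V]

/-- `ℓ` is the depth function of a complete full `2 * h`-ary tree with root
`r`, parent map `p` and depth `d`. -/
structure IsFullDepth (r : V) (p : V → V) (ℓ : V → ℕ) (h d : ℕ) : Prop where
  root : ℓ r = 0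
  parent : ∀ v, v ≠ r → ℓ v = ℓ (p v) + 1
  le : ∀ v, ℓ v ≤ d
  card : ∀ v, ℓ v < d → (childFinset r p v).card = 2 * h

namespace IsFullDepth

variable {r : V} {p : V → V} {ℓ : V → ℕ} {h d : ℕ}

theorem childFinset_eq_empty (H : IsFullDepth r p ℓ h d) {v : V} (hv : ℓ v = d) :
    childFinset r p v = ∅ := by
  refine eq_empty_of_forall_notMem fun w hw => ?_
  rw [mem_childFinset] at hw
  have h1 := H.parent w hw.1
  have h2 := H.le w
  rw [hw.2] at h1
  omega

theorem card_level_succ (H : IsFullDepth r p ℓ h d) {j : ℕ} (hj : j < d) :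
    (univ.filter fun v => ℓ v = j + 1).card = 2 * h * (univ.filter fun v => ℓ v = j).card := by
  rw [← card_filter_parent_mem (r := r) (p := p) (t := 2 * h)]
  · congr 1
    ext v
    simp only [mem_filter, mem_univ, true_and]
    constructor
    · intro hv
      have hr : v ≠ r := by rintro rfl; have := H.root; omega
      have := H.parent v hr
      exact ⟨hr, by omega⟩
    · rintro ⟨hr, hv⟩
      have := H.parent v hr
      omega
  · intro v hv
    exact H.card v (by have := (mem_filter.1 hv).2; omega)

theorem card_le_level_succ (H : IsFullDepth r p ℓ h d) {j : ℕ} (hj : j < d) :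
    (univ.filter fun v => ℓ v ≤ j + 1).card =
      2 * h * (univ.filter fun v => ℓ v ≤ j).card + 1 := by
  rw [← card_filter_parent_mem (r := r) (p := p) (t := 2 * h), ← card_insert_of_notMem (a := r)]
  · congr 1
    ext v
    simp only [mem_filter, mem_univ, true_and, mem_insert]
    by_cases hr : v = r
    · subst hr; simp [H.root]
    · have := H.parent v hr
      simp only [hr, false_or, ne_eq, not_false_eq_true, true_and]
      omega
  · simp
  · intro v hv
    exact H.card v (by have := (mem_filter.1 hv).2; omega)

theorem card_le_level_succ_eq_add (ℓ : V → ℕ) (j : ℕ) :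
    (univ.filter fun v => ℓ v ≤ j + 1).card =
      (univ.filter fun v => ℓ v ≤ j).card + (univ.filter fun v => ℓ v = j + 1).card := by
  rw [← card_union_of_disjoint]
  · congr 1
    ext v
    simp only [mem_filter, mem_univ, true_and, mem_union]
    omega
  · rw [disjoint_left]
    intro v h1 h2
    have := (mem_filter.1 h1).2
    have := (mem_filter.1 h2).2
    omega

theorem card_univ_eq (H : IsFullDepth r p ℓ h d) :
    (univ.filter fun v => ℓ v ≤ d).card = Fintype.card V := by
  rw [filter_true_of_mem fun v _ => H.le v, card_univ]

/-- In a tree of depth at least two, some labelling has at most two vertex sums that are not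
labels of the edges at the leaves. -/
theorem exists_labelling_of_two_le (H : IsFullDepth r p ℓ h (d + 2)) (hh : 1 ≤ h) :
    ∃ g : V → ℕ, Set.InjOn g {v | v ≠ r} ∧
      (∀ v, v ≠ r → 1 ≤ g v ∧ g v ≤ Fintype.card V - 1) ∧
      (∀ v, v ≠ r → rootedSum r p g v ≠ rootedSum r p g (p v)) ∧
      (univ.image (rootedSum r p g)).card ≤ (univ.filter fun v => ℓ v = d + 2).card + 2 := by
  obtain ⟨c, hc⟩ := exists_childIndex r p
  set W := univ.filter fun v => ℓ v ≤ d with hW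
  set X := univ.filter fun v => ℓ v < d with hX
  set Y := univ.filter fun v => ℓ v = d with hY
  set L := univ.filter fun v => ℓ v = d + 2 with hL
  have hXW : X ⊆ W := fun v hv => by
    rw [hX, mem_filter] at hv
    rw [hW, mem_filter]
    exact ⟨hv.1, hv.2.le⟩
  -- Depth d receives the last indices, so the edges just below it receive the middle labels x + 1,
  -- ..., x + 2k.
  obtain ⟨e, he, heW, heX⟩ := exists_injOn_subset_first hXW
  have hWcard : W.card = X.card + Y.card := by
    rw [← card_union_of_disjoint]
    · congr 1
      ext v
      simp only [hW, hX, hY, mem_filter, mem_univ, true_and, mem_union]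
      omega
    · rw [disjoint_left]
      intro v h1 h2
      have := (mem_filter.1 h1).2
      have := (mem_filter.1 h2).2
      omega
  have hLcard : L.card = 2 * h * (2 * (h * Y.card)) := by
    rw [hL, H.card_level_succ (by omega), H.card_level_succ (by omega)]
    ring
  have hWle : 2 * h * W.card + 1 = W.card + 2 * (h * Y.card) := by
    rw [← H.card_le_level_succ (by omega), card_le_level_succ_eq_add,
      H.card_level_succ (by omega)]
    ring
  have hVcard : Fintype.card V = 2 * (h * W.card) + 1 + L.card := by
    rw [← H.card_univ_eq, card_le_level_succ_eq_add, H.card_le_level_succ (by omega)]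
    ring
  have hWh : W.card ≤ h * W.card := Nat.le_mul_of_pos_left _ hh
  have hsplit : h * W.card = h * X.card + h * Y.card := by rw [hWcard, mul_add]
  have hnL : 2 * (2 * (h * Y.card)) ≤ L.card := by
    rw [hLcard]; exact Nat.mul_le_mul_right _ (by omega)
  rw [mul_assoc] at hWle
  set M := 2 * (h * W.card) with hM
  set x := h * X.card with hx
  set k := h * Y.card with hk
  let u : V → ℕ := fun v => upperLabel h (h * W.card) (e (p v)) (c v)
  -- The position of a vertex of depth d + 1 is read off its own label, so that its children can
  -- cancel that label.
  let g : V → ℕ := fun v => if ℓ v < d + 2 then u v else leafLabel M h k (u (p v) - x) (c v)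
  have hgu : ∀ v, ℓ v < d + 2 → g v = u v := fun v hv => if_pos hv
  have hgl : ∀ v, ℓ v = d + 2 → g v = leafLabel M h k (g (p v) - x) (c v) := by
    intro v hv
    have hr : v ≠ r := by rintro rfl; have := H.root; omega
    have := H.parent v hr
    rw [hgu (p v) (by omega)]
    exact if_neg (by omega)
  have hcv : ∀ v, v ≠ r → c v < 2 * h := by
    intro v hv
    have h1 := H.parent v hv
    have h2 := H.le v
    have h3 := (hc (p v)).mapsTo (mem_childFinset.2 ⟨hv, rfl⟩)
    rw [H.card (p v) (by omega)] at h3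
    simpa using h3
  have hcinj : ∀ v w, v ≠ r → w ≠ r → p v = p w → c v = c w → v = w := by
    intro v w hv hw h1 h2
    exact (hc (p v)).injOn (mem_childFinset.2 ⟨hv, rfl⟩) (mem_childFinset.2 ⟨hw, h1.symm⟩) h2
  have hsum : ∀ v, ℓ v < d + 2 → ∀ φ : ℕ → ℕ,
      ∑ w ∈ childFinset r p v, φ (c w) = ∑ j ∈ range (2 * h), φ j := by
    intro v hv φ
    rw [← H.card v hv]
    exact sum_nbij c (hc v).mapsTo (hc v).injOn (hc v).surjOn fun _ _ => rfl
  have hpW : ∀ v, v ≠ r → ℓ v < d + 2 → p v ∈ W := by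
    intro v hv hd
    have := H.parent v hv
    rw [hW, mem_filter]
    exact ⟨mem_univ _, by omega⟩
  have hgupper : ∀ v, v ≠ r → ℓ v < d + 2 → 1 ≤ g v ∧ g v ≤ M := by
    intro v hv hd
    have := upperLabel_bounds (hcv v hv) (Nat.zero_le _) (heW _ (hpW v hv hd))
    rw [hgu v hd]
    simpa using this
  have hgmid : ∀ v, ℓ v = d + 1 → x + 1 ≤ g v ∧ g v ≤ x + 2 * k := by
    intro v hd
    have hv : v ≠ r := by rintro rfl; have := H.root; omega
    have h1 := H.parent v hv
    have h2 : p v ∈ W \ X := by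
      rw [mem_sdiff]
      refine ⟨hpW v hv (by omega), fun h3 => ?_⟩
      have := (mem_filter.1 h3).2
      omega
    have := upperLabel_bounds (hcv v hv) (heX _ h2) (heW _ (hpW v hv (by omega)))
    rw [hgu v (by omega)]
    change x + 1 ≤ u v ∧ u v ≤ _ at this
    omega
  have hgleaf : ∀ v, ℓ v = d + 2 → M + 1 ≤ g v ∧ g v ≤ M + L.card := by
    intro v hd
    have hv : v ≠ r := by rintro rfl; have := H.root; omega
    have h1 := H.parent v hv
    have h2 := hgmid (p v) (by omega)
    rw [hgl v hd, hLcard]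
    exact leafLabel_bounds (hcv v hv) (by omega) (by omega)
  have hupinj : ∀ v w, v ≠ r → w ≠ r → ℓ v < d + 2 → ℓ w < d + 2 → g v = g w → v = w := by
    intro v w hv hw hdv hdw hvw
    rw [hgu v hdv, hgu w hdw] at hvw
    obtain ⟨h1, h2⟩ := upperLabel_inj (hcv v hv) (hcv w hw) (heW _ (hpW v hv hdv))
      (heW _ (hpW w hw hdw)) hvw
    exact hcinj v w hv hw (he (hpW v hv hdv) (hpW w hw hdw) h1) h2
  have hginj : Set.InjOn g {v | v ≠ r} := by
    intro v hv w hw hvw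
    have hv : v ≠ r := hv
    have hw : w ≠ r := hw
    rcases (H.le v).lt_or_eq with hdv | hdv <;> rcases (H.le w).lt_or_eq with hdw | hdw
    · exact hupinj v w hv hw hdv hdw hvw
    · have := hgupper v hv hdv; have := hgleaf w hdw; omega
    · have := hgupper w hw hdw; have := hgleaf v hdv; omega
    · have h1 := H.parent v hv
      have h2 := H.parent w hw
      have h3 := hgmid (p v) (by omega)
      have h4 := hgmid (p w) (by omega)
      rw [hgl v hdv, hgl w hdw] at hvw
      obtain ⟨h5, h6⟩ := leafLabel_inj (hcv v hv) (hcv w hw) (by omega) (by omega) (by omega)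
        (by omega) hvw
      have hr : ∀ z, ℓ z = d + 1 → z ≠ r := by
        rintro z hz rfl; have := H.root; omega
      exact hcinj v w hv hw (hupinj _ _ (hr _ (by omega)) (hr _ (by omega)) (by omega) (by omega)
        (by omega)) h6
  have hsW : ∀ v, ℓ v ≤ d → rootedSum r p g v = (if v = r then 0 else g v) + h * (M + 1) := by
    intro v hv
    have hvW : v ∈ W := by rw [hW, mem_filter]; exact ⟨mem_univ _, hv⟩
    rw [rootedSum, hM, ← sum_upperLabel (heW v hvW), ← hsum v (by omega)]
    congr 1
    refine sum_congr rfl fun w hw => ?_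
    rw [mem_childFinset] at hw
    have := H.parent w hw.1
    rw [hw.2] at this
    rw [hgu w (by omega), ← hw.2]
  set C := x + (2 * M + 5 * k + (h - 1) * (2 * M + (2 * h + 2) * (2 * k) + 1)) + 1 with hC
  have hsZ : ∀ v, ℓ v = d + 1 → rootedSum r p g v = C ∨ rootedSum r p g v = C + 1 := by
    intro v hv
    have hr : v ≠ r := by rintro rfl; have := H.root; omega
    have h1 := hgmid v hv
    have h2 : ∑ w ∈ childFinset r p v, g w =
        ∑ j ∈ range (2 * h), leafLabel M h k (g v - x) j := by
      rw [← hsum v (by omega)]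
      refine sum_congr rfl fun w hw => ?_
      rw [mem_childFinset] at hw
      have := H.parent w hw.1
      rw [hw.2] at this
      rw [hgl w (by omega), hw.2]
    have h3 := sum_leafLabel (M := M) (k := k) (i := g v - x) hh (by omega)
    rw [rootedSum, if_neg hr, h2]
    split_ifs at h3 <;> omega
  have hsL : ∀ v, ℓ v = d + 2 → rootedSum r p g v = g v := by
    intro v hv
    have hr : v ≠ r := by rintro rfl; have := H.root; omega
    rw [rootedSum, if_neg hr, H.childFinset_eq_empty hv, sum_empty, add_zero]
  have hCbig : M + L.card < C := by
    have h1 : (h - 1) * (2 * (2 * k)) ≤ (h - 1) * (2 * M + (2 * h + 2) * (2 * k) + 1) := by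
      refine Nat.mul_le_mul_left _ ?_
      have : 2 * (2 * k) ≤ (2 * h + 2) * (2 * k) := Nat.mul_le_mul_right _ (by omega)
      omega
    have h2 : L.card = (h - 1) * (2 * (2 * k)) + 2 * (2 * k) := by
      rw [hLcard, ← Nat.succ_mul, Nat.succ_eq_add_one, Nat.sub_add_cancel hh]
      ring
    omega
  have hWrange : ∀ v, ℓ v ≤ d → M + 1 ≤ rootedSum r p g v ∧ rootedSum r p g v ≤ M + L.card := by
    intro v hv
    rw [hsW v hv]
    have h1 : M + 1 ≤ h * (M + 1) := Nat.le_mul_of_pos_left _ hh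
    -- M + 1 = |W| + 2k, |W| ≤ x + k and M = 2x + 2k force x < k, hence M + 1 ≤ 4k.
    have h2 : h * (M + 1) ≤ h * (2 * (2 * k)) := Nat.mul_le_mul_left _ (by omega)
    have h3 : h * (2 * (2 * k)) = L.card := by rw [hLcard]; ring
    split_ifs with hr
    · omega
    · have := hgupper v hr (by omega)
      omega
  refine ⟨g, hginj, ?_, ?_, ?_⟩
  · intro v hv
    rcases (H.le v).lt_or_eq with hd | hd
    · have := hgupper v hv hd; omega
    · have := hgleaf v hd; omega
  · intro v hv
    have h1 := H.parent v hv
    have h2 := H.le v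
    rcases (show ℓ v ≤ d ∨ ℓ v = d + 1 ∨ ℓ v = d + 2 by omega) with hd | hd | hd
    · rw [hsW v hd, hsW (p v) (by omega), if_neg hv]
      have h3 := hgupper v hv (by omega)
      split_ifs with hr
      · omega
      · intro h4
        have := hupinj v (p v) hv hr (by omega) (by omega) (by omega)
        rw [← this] at h1
        omega
    · have := hsZ v hd
      have := hWrange (p v) (by omega)
      omega
    · have := hsZ (p v) (by omega)
      have := hgleaf v hd
      rw [hsL v hd]
      omega
  · have hsub : univ.image (rootedSum r p g) ⊆ Icc (M + 1) (M + L.card) ∪ {C, C + 1} := by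
      intro s hs
      obtain ⟨v, -, rfl⟩ := mem_image.1 hs
      rw [mem_union, mem_Icc, mem_insert, mem_singleton]
      have h2 := H.le v
      rcases (show ℓ v ≤ d ∨ ℓ v = d + 1 ∨ ℓ v = d + 2 by omega) with hd | hd | hd
      · exact Or.inl (hWrange v hd)
      · exact Or.inr (hsZ v hd)
      · rw [hsL v hd]
        exact Or.inl (hgleaf v hd)
    refine (card_le_card hsub).trans ((card_union_le _ _).trans ?_)
    rw [Nat.card_Icc]
    have := card_le_two (a := C) (b := C + 1)
    omega

/-- In a star, the centre is the only vertex whose sum is not an edge label. -/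
theorem exists_labelling_of_eq_one (H : IsFullDepth r p ℓ h 1) (hh : 1 ≤ h) :
    ∃ g : V → ℕ, Set.InjOn g {v | v ≠ r} ∧
      (∀ v, v ≠ r → 1 ≤ g v ∧ g v ≤ Fintype.card V - 1) ∧
      (∀ v, v ≠ r → rootedSum r p g v ≠ rootedSum r p g (p v)) ∧
      (univ.image (rootedSum r p g)).card ≤ (univ.filter fun v => ℓ v = 1).card + 2 := by
  obtain ⟨f, hf⟩ := exists_bijOn_range (univ.erase r)
  have hcard : (univ.erase r).card = Fintype.card V - 1 := by
    rw [card_erase_of_mem (mem_univ r), card_univ]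
  have hlev : ∀ v, v ≠ r → ℓ v = 1 := fun v hv => by
    have := H.parent v hv
    have := H.le v
    omega
  have hpar : ∀ v, v ≠ r → p v = r := fun v hv => by
    by_contra hr
    have h1 := H.parent v hv
    rw [hlev v hv, hlev _ hr] at h1
    omega
  have hsL : ∀ v, v ≠ r → rootedSum r p (fun v => f v + 1) v = f v + 1 := by
    intro v hv
    rw [rootedSum, if_neg hv, H.childFinset_eq_empty (hlev v hv), sum_empty, add_zero]
  have hroot : ∀ v, v ≠ r → f v + 1 < rootedSum r p (fun v => f v + 1) r := by
    intro v hv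
    have hvr : v ∈ childFinset r p r := mem_childFinset.2 ⟨hv, hpar v hv⟩
    obtain ⟨w, hw, hwv⟩ := exists_mem_ne (s := childFinset r p r)
      (by rw [H.card r (by rw [H.root]; omega)]; omega) v
    rw [rootedSum, if_pos rfl, zero_add, ← add_sum_erase _ _ hvr]
    have := single_le_sum (f := fun v => f v + 1) (fun _ _ => Nat.zero_le _)
      (mem_erase.2 ⟨hwv, hw⟩)
    omega
  refine ⟨fun v => f v + 1, ?_, ?_, ?_, ?_⟩
  · intro v hv w hw hvw
    exact hf.injOn (mem_erase.2 ⟨hv, mem_univ _⟩) (mem_erase.2 ⟨hw, mem_univ _⟩)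
      (Nat.succ_injective hvw)
  · intro v hv
    have := hf.mapsTo (mem_erase.2 ⟨hv, mem_univ _⟩)
    rw [hcard, coe_range, Set.mem_Iio] at this
    dsimp only
    omega
  · intro v hv
    rw [hsL v hv, hpar v hv]
    exact (hroot v hv).ne
  -- A star has only l + 1 vertices, so counting vertices already bounds the colours.
  · have h1 : (univ : Finset V) = insert r (univ.filter fun v => ℓ v = 1) := by
      ext v
      by_cases hv : v = r
      · simp [hv]
      · simp [hlev v hv]
    calc _ ≤ (univ : Finset V).card := card_image_le
      _ ≤ _ := by
        rw [h1]
        refine (card_insert_le _ _).trans ?_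
        rw [← h1]
        omega

end IsFullDepth

end Labelling

/-- A deepest vertex has no children; as all childless vertices have the same depth, every shallower
vertex has its full set of children. -/
theorem exists_isFullDepth {V : Type*} [Fintype V] [DecidableEq V] [Nontrivial V]
    {T : SimpleGraph V} {r : V} {p : V → V} {h : ℕ} (hT : IsCompleteFullTree T r (2 * h))
    (hp : ∀ w, w ≠ r → ∀ a, (T.Adj a w ∧ T.dist r w = T.dist r a + 1) ↔ p w = a) :
    ∃ d, 1 ≤ d ∧ IsFullDepth r p (T.dist r) h d := by
  have hch : ∀ v, rootedChildren T r v = childFinset r p v := by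
    intro v
    ext w
    rw [mem_coe, mem_childFinset]
    constructor
    · rintro ⟨h1, h2⟩
      have hw : w ≠ r := by rintro rfl; simp at h2
      exact ⟨hw, (hp w hw v).1 ⟨h1, h2⟩⟩
    · rintro ⟨hw, h1⟩
      exact (hp w hw v).2 h1
  obtain ⟨v, -, hv⟩ := exists_max_image univ (T.dist r) univ_nonempty
  have hv0 : rootedChildren T r v = ∅ := by
    refine Set.eq_empty_of_forall_notMem fun w hw => ?_
    have := hv w (mem_univ _)
    have := hw.2
    omega
  refine ⟨T.dist r v, ?_, SimpleGraph.dist_self, fun w hw => ((hp w hw _).2 rfl).2,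
    fun w => hv w (mem_univ _), fun w hw => ?_⟩
  · obtain ⟨w, hw⟩ := exists_ne r
    have := hT.isTree.connected.pos_dist_of_ne hw.symm
    have := hv w (mem_univ _)
    omega
  · rw [← hT.ncard_children w fun h0 => hw.ne (hT.depth_eq w v h0 hv0), hch, Set.ncard_coe_finset]

theorem theorem5p1 {V : Type*} [Fintype V] [DecidableEq V] [Nontrivial V] (T : SimpleGraph V)
    [DecidableRel T.Adj] (r : V) (t : ℕ) (ht : 2 ≤ t) (ht_even : Even t)
    (hT : IsCompleteFullTree T r t) (l : ℕ)
    (hl : l = (Finset.univ.filter fun v : V => T.degree v = 1).card) :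
    (l : ℕ∞) + 1 ≤ localAntimagicChromaticNumber T ∧
      localAntimagicChromaticNumber T ≤ (l : ℕ∞) + 2 := by
  obtain ⟨h, rfl⟩ := ht_even.two_dvd
  have hh : 1 ≤ h := by omega
  constructor
  · rw [hl]
    refine le_localAntimagicChromaticNumber ?_
    have := hT.isTree.card_edgeFinset
    have := Fintype.one_lt_card (α := V)
    omega
  · obtain ⟨p, hp⟩ := exists_parent hT.isTree r
    obtain ⟨d, hd, H⟩ := exists_isFullDepth hT hp
    have hleaf : (univ.filter fun v => T.dist r v = d) =
        univ.filter fun v : V => T.degree v = 1 := by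
      ext v
      simp only [mem_filter, mem_univ, true_and, degree_eq_parent hT.isTree hp v]
      constructor
      · intro hv
        have hr : v ≠ r := by rintro rfl; have := H.root; omega
        rw [H.childFinset_eq_empty hv, if_neg hr, card_empty]
      · intro hv
        -- A vertex above the last level, the root included, has at least 2h ≥ 2 neighbours.
        by_contra hne
        rw [H.card v (lt_of_le_of_ne (H.le v) hne)] at hv
        omega
    obtain ⟨g, hinj, hmaps, hne, hcard⟩ : ∃ g : V → ℕ, Set.InjOn g {v | v ≠ r} ∧
        (∀ v, v ≠ r → 1 ≤ g v ∧ g v ≤ Fintype.card V - 1) ∧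
        (∀ v, v ≠ r → rootedSum r p g v ≠ rootedSum r p g (p v)) ∧
        (univ.image (rootedSum r p g)).card ≤ (univ.filter fun v => T.dist r v = d).card + 2 := by
      obtain rfl | ⟨d, rfl⟩ : d = 1 ∨ ∃ d', d = d' + 2 := by
        rcases hd.eq_or_lt with h1 | h1
        · exact Or.inl h1.symm
        · exact Or.inr ⟨d - 2, by omega⟩
      · exact H.exists_labelling_of_eq_one hh
      · exact H.exists_labelling_of_two_le hh
    refine (iInf₂_le _ (isLocalAntimagicLabeling_edgeLabel hT.isTree hp hinj hmaps hne)).trans ?_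
    rw [funext (vertexSum_edgeLabel hT.isTree hp g), hl, ← hleaf]
    exact_mod_cast hcard
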